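/- Let $\mathbb D$ be the open unit disk, $\mathbb T$ the unit circle and $m$ normalized Lebesgue measure on $\mathbb T$; functions in $\mathbb D$ are identified with their boundary values on $\mathbb T$ where these exist a.e. For an inner function $I$ let $\sigma(I)=\{\lambda\in\overline{\mathbb D}:\liminf_{z\to\lambda,\,z\in\mathbb D}|I(z)|=0\}$ be its spectrum and $K^2_I=H^2\cap I\,\overline{H^2_0}$, where $H^2_0=\{f\in H^2: f(0)=0\}$. For an outer function $g\in H^2$ let $H^2(|g|^2)$ be the space of holomorphic $f$ on $\mathbb D$ with $\sup_{0<r<1}\int_{\mathbb T}|f(r\zeta)|^2|g(r\zeta)|^2\,dm(\zeta)<\infty$, let $H^2_0(|g|^2)=\{f\in H^2(|g|^2):f(0)=0\}$, and $K^2_I(|g|^2)=H^2(|g|^2)\cap I\,\overline{H^2_0(|g|^2)}$. There exist an inner function $I$, namely $I(z)=\exp\frac{z+1}{z-1}$, a sequence $(\Gamma_n)_{n}$ of pairwise disjoint closed (nondegenerate) arcs of $\mathbb T$ not meeting $\sigma(I)$, and a constant $\delta>0$, such that, with $\Gamma=\bigcup_n\Gamma_n$, the following holds. For every exponent $0<s<2$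 there is an outer function $g\in H^2$ with $1/g\in L^s(\Gamma)$ and with $|g|\ge\delta$ and $|1/g|\ge\delta$ a.e. on $\mathbb T\setminus\Gamma$, but $K^2_I(|g|^2)\not\subset K^2_I$. -/

import Mathlib

open MeasureTheory Filter Topology Metric
open scoped ENNReal ComplexConjugate

noncomputable section

namespace HardyModel

/-- The open unit disk. -/
abbrev unitDisk : Set ℂ := ball (0 : ℂ) 1

/-- Normalized arc length on the unit circle, viewed as a measure on `ℂ`:
the image of `dt / 2π` on `(-π, π]` under `t ↦ exp (i t)`. -/
def arcMeasure : Measure ℂ :=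
  (ENNReal.ofReal (2 * Real.pi))⁻¹ •
    (volume.restrict (Set.Ioc (-Real.pi) Real.pi)).map (fun t : ℝ => circleMap 0 1 t)

/-- Boundary function of a function on the disk: its radial limit at the point `ζ` of the circle.
(For all the functions considered below these limits exist almost everywhere, and they agree
almost everywhere with the nontangential limits.) -/
def boundaryValue (f : ℂ → ℂ) (ζ : ℂ) : ℂ :=
  limUnder (𝓝[<] (1 : ℝ)) (fun r : ℝ => f (r * ζ))

/-- The Hardy space `H²`. The values of the functions outside of the disk play no role. -/
def hardyTwo : Set (ℂ → ℂ) :=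
  {f | DifferentiableOn ℂ f unitDisk ∧
    (⨆ r ∈ Set.Ioo (0 : ℝ) 1, ∫⁻ ζ, ‖f (r * ζ)‖ₑ ^ 2 ∂arcMeasure) < ⊤}

/-- The weighted Hardy space `H²(|g|²)`. -/
def weightedHardyTwo (g : ℂ → ℂ) : Set (ℂ → ℂ) :=
  {f | DifferentiableOn ℂ f unitDisk ∧
    (⨆ r ∈ Set.Ioo (0 : ℝ) 1, ∫⁻ ζ, ‖f (r * ζ)‖ₑ ^ 2 * ‖g (r * ζ)‖ₑ ^ 2 ∂arcMeasure) < ⊤}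

/-- Inner functions: bounded analytic functions on the disk whose boundary values have
modulus one almost everywhere. -/
def IsInner (I : ℂ → ℂ) : Prop :=
  DifferentiableOn ℂ I unitDisk ∧ (∃ C : ℝ, ∀ z ∈ unitDisk, ‖I z‖ ≤ C) ∧
    ∀ᵐ ζ ∂arcMeasure, ‖boundaryValue I ζ‖ = 1

/-- Outer functions: `g z = c * exp (∫ (ζ + z) / (ζ - z) * u ζ dm(ζ))` on the disk, with `|c| = 1`
and `u` real and integrable (so that `u` is the logarithm of the boundary modulus of `g`). -/
def IsOuter (g : ℂ → ℂ) : Prop :=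
  ∃ (c : ℂ) (u : ℂ → ℝ), ‖c‖ = 1 ∧ Integrable u arcMeasure ∧
    ∀ z ∈ unitDisk, g z = c * Complex.exp (∫ ζ, (ζ + z) / (ζ - z) * (u ζ : ℂ) ∂arcMeasure)

/-- The spectrum of an inner function: the points of the closed disk at which the lower limit
of `|I|` along the open disk is zero. -/
def innerSpectrum (I : ℂ → ℂ) : Set ℂ :=
  {w | w ∈ closedBall (0 : ℂ) 1 ∧ liminf (fun z => ‖I z‖ₑ) (𝓝[unitDisk] w) = 0}

/-- The model space `K²_I = H² ∩ I * conj (H²₀)`, the second factor being taken on the circle. -/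
def modelSpace (I : ℂ → ℂ) : Set (ℂ → ℂ) :=
  {f | f ∈ hardyTwo ∧ ∃ ψ ∈ hardyTwo, ψ 0 = 0 ∧
    ∀ᵐ ζ ∂arcMeasure, boundaryValue f ζ = boundaryValue I ζ * conj (boundaryValue ψ ζ)}

/-- The weighted model space `K²_I(|g|²) = H²(|g|²) ∩ I * conj (H²₀(|g|²))`. -/
def weightedModelSpace (I g : ℂ → ℂ) : Set (ℂ → ℂ) :=
  {f | f ∈ weightedHardyTwo g ∧ ∃ ψ ∈ weightedHardyTwo g, ψ 0 = 0 ∧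
    ∀ᵐ ζ ∂arcMeasure, boundaryValue f ζ = boundaryValue I ζ * conj (boundaryValue ψ ζ)}

/-- Closed (nondegenerate, proper) arcs of the unit circle. -/
def IsClosedArc (A : Set ℂ) : Prop :=
  ∃ a b : ℝ, a < b ∧ b < a + 2 * Real.pi ∧ A = (fun t : ℝ => circleMap 0 1 t) '' Set.Icc a b

end HardyModel

end

open HardyModel

namespace HardyModel

/-! The spectrum of `atomicInner` lies away from `-1`, and the first arc is a neighbourhood of `-1`
in the circle, so everything can be spoiled at that one point. The weight is `g = (1 + z) ^ α`: near
`-1`, `1/g` lies in `L^s` when `α * s < 1`, and since `s < 2` this leaves room for `α > 1/2`.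

For such `α`, a simple pole at `-1` is square integrable against `|g|²` but not without the weight.
To get an element of the weighted model space with such a pole, take the reproducing kernel `1 - e⁻¹
I` at `0` and multiply it by `i (1 - z) / (1 + z)`, which is real on the circle. The factor passes
through the conjugation `f ↦ I * conj f`, so the boundary identity for the kernel survives
(`kernelPole_mem_weightedModelSpace`). Since `|I| ≤ 1`, the kernel is bounded below by `1/2`, so the
pole is genuine (`kernelPole_notMem_hardyTwo`).

The analytic work is to show that `g` is outer, through the Schwarz integral of `log |1 + ζ|`. Only
the first arc matters; the others complete the sequence, which does not depend on `s`. -/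

/-! ### Normalized arc length in the angular coordinate. -/

lemma measurable_circleMap_zero_one : Measurable (fun t : ℝ => circleMap 0 1 t) :=
  (continuous_circleMap 0 1).measurable

lemma lintegral_arcMeasure {f : ℂ → ℝ≥0∞} (hf : Measurable f) :
    ∫⁻ ζ, f ζ ∂arcMeasure = (ENNReal.ofReal (2 * Real.pi))⁻¹ *
      ∫⁻ t in Set.Ioc (-Real.pi) Real.pi, f (circleMap 0 1 t) := by
  rw [arcMeasure, lintegral_smul_measure, lintegral_map hf measurable_circleMap_zero_one,
    smul_eq_mul]

lemma ofReal_two_pi_inv_ne_zero : (ENNReal.ofReal (2 * Real.pi))⁻¹ ≠ 0 :=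
  ENNReal.inv_ne_zero.2 ENNReal.ofReal_ne_top

lemma ofReal_two_pi_ne_zero : ENNReal.ofReal (2 * Real.pi) ≠ 0 := by
  simp [Real.pi_pos]

instance : IsProbabilityMeasure arcMeasure := by
  refine ⟨?_⟩
  rw [arcMeasure, Measure.smul_apply, Measure.map_apply measurable_circleMap_zero_one .univ]
  simp only [Set.preimage_univ, Measure.restrict_apply_univ, Real.volume_Ioc, smul_eq_mul]
  rw [show Real.pi - -Real.pi = 2 * Real.pi by ring]
  exact ENNReal.inv_mul_cancel ofReal_two_pi_ne_zero ENNReal.ofReal_ne_top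

lemma ae_arcMeasure_iff {p : ℂ → Prop} (hp : MeasurableSet {ζ | p ζ}) :
    (∀ᵐ ζ ∂arcMeasure, p ζ) ↔
      ∀ᵐ t ∂(volume.restrict (Set.Ioc (-Real.pi) Real.pi)), p (circleMap 0 1 t) := by
  rw [arcMeasure, Measure.ae_ennreal_smul_measure_iff ofReal_two_pi_inv_ne_zero,
    ae_map_iff measurable_circleMap_zero_one.aemeasurable hp]

lemma ae_arcMeasure_norm_eq_one : ∀ᵐ ζ ∂arcMeasure, ‖ζ‖ = 1 := by
  rw [ae_arcMeasure_iff (measurableSet_eq_fun measurable_norm measurable_const)]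
  exact ae_of_all _ fun t => by simp

lemma ae_arcMeasure_ne (a : ℂ) : ∀ᵐ ζ ∂arcMeasure, ζ ≠ a := by
  refine (ae_arcMeasure_iff (p := fun ζ => ζ ≠ a) (measurableSet_singleton a).compl).2 ?_
  refine ae_restrict_of_ae ?_
  exact ((Set.countable_singleton a).preimage_circleMap 0 one_ne_zero).ae_notMem _

lemma integrable_arcMeasure_iff {E : Type*} [NormedAddCommGroup E] {f : ℂ → E}
    (hf : StronglyMeasurable f) :
    Integrable f arcMeasure ↔
      IntegrableOn (fun t => f (circleMap 0 1 t)) (Set.Ioc (-Real.pi) Real.pi) := by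
  rw [arcMeasure, integrable_smul_measure ofReal_two_pi_inv_ne_zero (by simp [Real.pi_pos]),
    integrable_map_measure hf.aestronglyMeasurable measurable_circleMap_zero_one.aemeasurable]
  rfl

lemma integral_arcMeasure {f : ℂ → ℂ} (hf : StronglyMeasurable f) :
    ∫ ζ, f ζ ∂arcMeasure = Real.circleAverage f 0 1 := by
  rw [arcMeasure, integral_smul_measure, integral_map measurable_circleMap_zero_one.aemeasurable
    hf.aestronglyMeasurable, Real.circleAverage_eq_integral_add (-Real.pi),
    intervalIntegral.integral_comp_add_right (fun θ => f (circleMap 0 1 θ)),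
    intervalIntegral.integral_of_le (by linarith [Real.pi_pos])]
  rw [ENNReal.toReal_inv, ENNReal.toReal_ofReal (by positivity)]
  congr 3
  ring_nf

/-! ### Integrability of powers and of the logarithm of the chord. -/

/-- Jordan's inequality for the chord from `-1` to `exp (i t)`. -/
lemma le_norm_one_add_circleMap {t : ℝ} (ht : t ∈ Set.Icc (-Real.pi) Real.pi) :
    2 / Real.pi * (Real.pi - |t|) ≤ ‖1 + circleMap 0 1 t‖ := by
  have hpi := Real.pi_pos
  have ht' : |t| ≤ Real.pi := abs_le.2 ht
  have h1 : ‖1 + circleMap 0 1 t‖ ^ 2 = (2 * Real.cos (t / 2)) ^ 2 := by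
    have h2 := Real.cos_sq_add_sin_sq t
    have h3 : Real.cos t = 2 * Real.cos (t / 2) ^ 2 - 1 := by
      rw [← Real.cos_two_mul]; ring_nf
    rw [← Complex.normSq_eq_norm_sq, Complex.normSq_apply]
    simp only [circleMap, zero_add, Complex.ofReal_one, one_mul, Complex.add_re, Complex.one_re,
      Complex.exp_ofReal_mul_I_re, Complex.add_im, Complex.one_im, Complex.exp_ofReal_mul_I_im]
    nlinarith
  have h2 : 0 ≤ Real.cos (t / 2) :=
    Real.cos_nonneg_of_mem_Icc ⟨by linarith [ht.1], by linarith [ht.2]⟩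
  have h3 : ‖1 + circleMap 0 1 t‖ = 2 * Real.cos (t / 2) :=
    (sq_eq_sq₀ (norm_nonneg _) (by positivity)).1 h1
  have h4 : Real.cos (t / 2) = Real.sin ((Real.pi - |t|) / 2) := by
    rw [← Real.cos_abs, abs_div, abs_two, ← Real.sin_pi_div_two_sub]
    ring_nf
  have h5 := Real.mul_le_sin (x := (Real.pi - |t|) / 2) (by linarith)
    (by linarith [abs_nonneg t])
  rw [h3, h4]
  calc _ = 2 * (2 / Real.pi * ((Real.pi - |t|) / 2)) := by ring
    _ ≤ _ := by linarith

/-- By Jordan's inequality the chord dominates the distance from `t` to the nearer of `±π`, so the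
sum of two one-sided powers with exponent `-β > -1` is an integrable majorant. -/
lemma integrable_norm_one_add_rpow {β : ℝ} (hβ₀ : 0 ≤ β) (hβ : β < 1) :
    Integrable (fun ζ : ℂ => ‖1 + ζ‖ ^ (-β)) arcMeasure := by
  have hpi := Real.pi_pos
  have hm : Measurable (fun ζ : ℂ => ‖1 + ζ‖ ^ (-β)) := by fun_prop
  rw [integrable_arcMeasure_iff hm.stronglyMeasurable]
  have h0 : ∀ a b : ℝ, IntervalIntegrable (fun x : ℝ => x ^ (-β)) volume a b := fun a b =>
    intervalIntegral.intervalIntegrable_rpow' (by linarith)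
  have h1 : IntervalIntegrable (fun t : ℝ => (Real.pi - t) ^ (-β)) volume (-Real.pi) Real.pi := by
    have := (h0 (2 * Real.pi) 0).comp_sub_left Real.pi
    rwa [show Real.pi - 2 * Real.pi = -Real.pi by ring, sub_zero] at this
  have h2 : IntervalIntegrable (fun t : ℝ => (t + Real.pi) ^ (-β)) volume (-Real.pi) Real.pi := by
    have := (h0 0 (2 * Real.pi)).comp_add_right Real.pi
    rwa [zero_sub, show 2 * Real.pi - Real.pi = Real.pi by ring] at this
  have h3 := ((h1.add h2).const_mul ((2 / Real.pi) ^ (-β)))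
  rw [intervalIntegrable_iff_integrableOn_Ioc_of_le (by linarith)] at h3
  refine Integrable.mono' h3
    (hm.comp measurable_circleMap_zero_one).aestronglyMeasurable ?_
  have hne : ∀ᵐ t : ℝ ∂(volume.restrict (Set.Ioc (-Real.pi) Real.pi)), t ≠ Real.pi :=
    ae_restrict_of_ae (by simp [ae_iff])
  filter_upwards [ae_restrict_mem measurableSet_Ioc, hne] with t ht hne
  have hlt : t < Real.pi := lt_of_le_of_ne ht.2 hne
  have habs : 0 < Real.pi - |t| := by
    have : |t| < Real.pi := abs_lt.2 ⟨ht.1, hlt⟩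
    linarith
  rw [Real.norm_of_nonneg (by positivity)]
  calc ‖1 + circleMap 0 1 t‖ ^ (-β) ≤ (2 / Real.pi * (Real.pi - |t|)) ^ (-β) :=
        Real.rpow_le_rpow_of_nonpos (by positivity)
          (le_norm_one_add_circleMap ⟨ht.1.le, ht.2⟩) (by linarith)
    _ = (2 / Real.pi) ^ (-β) * (Real.pi - |t|) ^ (-β) :=
        Real.mul_rpow (by positivity) habs.le
    _ ≤ _ := by
        refine mul_le_mul_of_nonneg_left ?_ (by positivity)
        have p1 : 0 ≤ (Real.pi - t) ^ (-β) := Real.rpow_nonneg (by linarith) _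
        have p2 : 0 ≤ (t + Real.pi) ^ (-β) := Real.rpow_nonneg (by linarith [ht.1]) _
        rcases abs_cases t with ⟨h, -⟩ | ⟨h, -⟩
        · rw [h]; linarith
        · rw [h, sub_neg_eq_add, add_comm]; linarith

lemma integrable_log_norm_one_add :
    Integrable (fun ζ : ℂ => Real.log ‖1 + ζ‖) arcMeasure := by
  have hm : Measurable (fun ζ : ℂ => Real.log ‖1 + ζ‖) := by fun_prop
  have h := circleIntegrable_log_norm_sub_const (a := -1) (c := 0) 1
  rw [integrable_arcMeasure_iff hm.stronglyMeasurable]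
  have hp : (fun t : ℝ => Real.log ‖circleMap 0 1 t - -1‖).Periodic (2 * Real.pi) := fun t => by
    simp only [periodic_circleMap 0 1 t]
  have h' := (hp.intervalIntegrable (t := 0) Real.two_pi_pos.ne'
    (by simpa [CircleIntegrable] using h) (-Real.pi) Real.pi)
  rw [intervalIntegrable_iff_integrableOn_Ioc_of_le (by linarith [Real.pi_pos])] at h'
  simpa [add_comm] using h'

/-- The number `1 - r` is both the distance from `ζ` to `rζ` and a lower bound for `|1 + rζ|`. This
makes the estimates on circles of radius `r` uniform in `r`. -/
lemma half_norm_one_add_le {ζ : ℂ} (hζ : ‖ζ‖ = 1) {r : ℝ} (h₀ : 0 ≤ r) (h₁ : r ≤ 1) :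
    ‖1 + ζ‖ / 2 ≤ ‖1 + r * ζ‖ := by
  have h2 : ‖(1 + ζ) - (1 + r * ζ)‖ = 1 - r := by
    rw [show (1 + ζ) - (1 + r * ζ) = ((1 - r : ℝ) : ℂ) * ζ by push_cast; ring, norm_mul, hζ,
      Complex.norm_real, Real.norm_of_nonneg (by linarith), mul_one]
  have h3 : 1 - r ≤ ‖1 + r * ζ‖ := by
    have := norm_sub_norm_le (1 : ℂ) (-(r * ζ))
    simpa [hζ, abs_of_nonneg h₀] using this
  have h4 := norm_sub_norm_le (1 + ζ) (1 + r * ζ)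
  linarith

/-! ### Schwarz's formula and its extension to `log |1 + ζ|`. -/

/-- Schwarz's integral formula. -/
lemma circleAverage_schwarz_kernel_mul_re {F : ℂ → ℂ} (hF : DiffContOnCl ℂ F (ball 0 1))
    (hF₀ : F 0 = 0) {z : ℂ} (hz : z ∈ ball (0 : ℂ) 1) :
    Real.circleAverage (fun ζ => (ζ + z) / (ζ - z) * ((F ζ).re : ℂ)) 0 1 = F z := by
  have hF' : DiffContOnCl ℂ F (ball 0 |1|) := by simpa using hF
  have hz' : z ∈ ball (0 : ℂ) |1| := by simpa using hz
  have hz1 : ‖z‖ < 1 := by simpa using hz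
  have hcF : ContinuousOn F (sphere 0 1) := by
    have := hF.2
    rw [closure_ball _ one_ne_zero] at this
    exact this.mono sphere_subset_closedBall
  have hne : ∀ ζ ∈ sphere (0 : ℂ) 1, ζ - z ≠ 0 := by
    intro ζ hζ h
    rw [sub_eq_zero] at h
    subst h
    simp at hζ
    linarith
  have hden : ∀ ζ ∈ closedBall (0 : ℂ) 1, 1 - conj z * ζ ≠ 0 := by
    intro ζ hζ h
    have h1 : ‖conj z * ζ‖ = 1 := by rw [← sub_eq_zero.1 h]; simp
    rw [norm_mul, RCLike.norm_conj] at h1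
    have : ‖ζ‖ ≤ 1 := by simpa using hζ
    nlinarith [norm_nonneg z, norm_nonneg ζ]
  have hG : DiffContOnCl ℂ (fun ζ => (1 + conj z * ζ) / (1 - conj z * ζ) * F ζ) (ball 0 |1|) := by
    have hk : DiffContOnCl ℂ (fun ζ => (1 + conj z * ζ) / (1 - conj z * ζ)) (ball 0 |1|) := by
      refine DifferentiableOn.diffContOnCl ?_
      rw [abs_one, closure_ball _ one_ne_zero]
      exact DifferentiableOn.div (by fun_prop) (by fun_prop) hden
    simpa [smul_eq_mul] using hk.smul hF'
  have e1 : Real.circleAverage (fun ζ => (ζ / (ζ - z)) * F ζ) 0 1 = F z := by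
    simpa using hF'.circleAverage_smul_div hz'
  have e2 : Real.circleAverage F 0 1 = 0 := by
    rw [hF'.circleAverage, hF₀]
  have e3 : Real.circleAverage (fun ζ => conj ((1 + conj z * ζ) / (1 - conj z * ζ) * F ζ)) 0 1
      = 0 := by
    have hi : CircleIntegrable (fun ζ => (1 + conj z * ζ) / (1 - conj z * ζ) * F ζ) 0 1 := by
      refine ContinuousOn.circleIntegrable zero_le_one ?_
      have := hG.2
      rw [abs_one, closure_ball _ one_ne_zero] at this
      exact this.mono sphere_subset_closedBall
    have := (Complex.conjCLE : ℂ →L[ℝ] ℂ).circleAverage_comp_comm hi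
    rw [hG.circleAverage, hF₀] at this
    simpa [Function.comp_def] using this
  have hi1 : CircleIntegrable (fun ζ => (ζ / (ζ - z)) * F ζ) 0 1 :=
    ContinuousOn.circleIntegrable zero_le_one
      ((ContinuousOn.div continuousOn_id (by fun_prop) hne).mul hcF)
  have hi2 : CircleIntegrable (fun ζ => (1 / 2 : ℂ) * F ζ) 0 1 :=
    ContinuousOn.circleIntegrable zero_le_one (by fun_prop)
  have hi3 : CircleIntegrable
      (fun ζ => (1 / 2 : ℂ) * conj ((1 + conj z * ζ) / (1 - conj z * ζ) * F ζ)) 0 1 := by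
    refine ContinuousOn.circleIntegrable zero_le_one (continuousOn_const.mul ?_)
    have := hG.2
    rw [abs_one, closure_ball _ one_ne_zero] at this
    exact Complex.continuous_conj.comp_continuousOn (this.mono sphere_subset_closedBall)
  -- Write `Re F = (F + conj F) / 2`. Against `F` the kernel is `2ζ / (ζ - z) - 1`; against `conj F`
  -- it is the conjugate, on the circle, of a function analytic across the closed disk. The three
  -- averages are then `F z`, `F 0 = 0` and `conj (F 0) = 0`, up to constants.
  have key : Set.EqOn (fun ζ => (ζ + z) / (ζ - z) * ((F ζ).re : ℂ))
      (fun ζ => (ζ / (ζ - z)) * F ζ - (1 / 2 : ℂ) * F ζ +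
        (1 / 2 : ℂ) * conj ((1 + conj z * ζ) / (1 - conj z * ζ) * F ζ)) (sphere 0 |1|) := by
    intro ζ hζ
    rw [abs_one] at hζ
    have h1 := hne ζ hζ
    have hζ1 : ‖ζ‖ = 1 := by simpa using hζ
    have hζ0 : ζ ≠ 0 := by rintro rfl; simp at hζ1
    have hc : conj ζ = ζ⁻¹ := by
      rw [Complex.inv_def, Complex.normSq_eq_norm_sq, hζ1]; simp
    have h2 : 1 - z * ζ⁻¹ ≠ 0 := by
      intro h
      apply h1
      field_simp at h
      simpa using h
    have h3 : (1 + z * ζ⁻¹) / (1 - z * ζ⁻¹) = (ζ + z) / (ζ - z) := by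
      field_simp
    simp only [map_mul, map_div₀, map_add, map_sub, map_one, Complex.conj_conj, hc, h3,
      Complex.re_eq_add_conj]
    field_simp
    ring
  rw [Real.circleAverage_congr_sphere key, Real.circleAverage_fun_add (hi1.fun_sub hi2) hi3,
    Real.circleAverage_fun_sub hi1 hi2, e1]
  have e4 := Real.circleAverage_fun_smul (𝕜 := ℂ) (a := (1 / 2 : ℂ)) (f := F) (c := 0) (R := 1)
  have e5 := Real.circleAverage_fun_smul (𝕜 := ℂ) (a := (1 / 2 : ℂ))
    (f := fun ζ => conj ((1 + conj z * ζ) / (1 - conj z * ζ) * F ζ)) (c := 0) (R := 1)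
  simp only [smul_eq_mul] at e4 e5
  rw [e4, e5, e2, e3]
  simp

lemma re_one_add_pos {z : ℂ} (hz : ‖z‖ ≤ 1) (hne : z ≠ -1) : 0 < (1 + z).re := by
  have h1 : z.re ^ 2 + z.im ^ 2 ≤ 1 := by
    have := Complex.normSq_eq_norm_sq z
    rw [Complex.normSq_apply] at this
    nlinarith [norm_nonneg z]
  by_contra h
  simp only [Complex.add_re, Complex.one_re, not_lt] at h
  apply hne
  have hre : z.re = -1 := by nlinarith [sq_nonneg z.im]
  have him : z.im = 0 := by
    have : z.im ^ 2 ≤ 0 := by rw [hre] at h1; linarith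
    nlinarith
  exact Complex.ext (by simpa using hre) (by simpa using him)

lemma ne_neg_one_of_norm_lt {z : ℂ} (hz : ‖z‖ < 1) : z ≠ -1 := by
  rintro rfl; simp at hz

lemma one_add_mem_slitPlane {z : ℂ} (hz : ‖z‖ ≤ 1) (hne : z ≠ -1) : 1 + z ∈ Complex.slitPlane :=
  Or.inl (re_one_add_pos hz hne)

lemma one_add_ne_zero {z : ℂ} (hne : z ≠ -1) : 1 + z ≠ 0 := fun h =>
  hne (by linear_combination h)

lemma norm_ofReal_mul_lt_one {ζ : ℂ} (hζ : ‖ζ‖ = 1) {r : ℝ} (hr : r ∈ Set.Ioo (0 : ℝ) 1) :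
    ‖(r : ℂ) * ζ‖ < 1 := by
  simpa [hζ, abs_of_pos hr.1] using hr.2

/-- The Schwarz integral of `log |1 + ζ|`. -/
lemma integral_schwarz_kernel_mul_log {z : ℂ} (hz : z ∈ unitDisk) :
    ∫ ζ, (ζ + z) / (ζ - z) * ((Real.log ‖1 + ζ‖ : ℝ) : ℂ) ∂arcMeasure = Complex.log (1 + z) := by
  have hz1 : ‖z‖ < 1 := by simpa using hz
  have hev : ∀ᶠ r : ℝ in 𝓝[<] 1, r ∈ Set.Ioo (0 : ℝ) 1 := Ioo_mem_nhdsLT one_pos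
  have hmeas : ∀ r : ℝ, StronglyMeasurable
      (fun ζ : ℂ => (ζ + z) / (ζ - z) * ((Real.log ‖1 + r * ζ‖ : ℝ) : ℂ)) := fun r =>
    Measurable.stronglyMeasurable (by fun_prop)
  have hr : ∀ r ∈ Set.Ioo (0 : ℝ) 1,
      ∫ ζ, (ζ + z) / (ζ - z) * ((Real.log ‖1 + r * ζ‖ : ℝ) : ℂ) ∂arcMeasure =
        Complex.log (1 + r * z) := by
    intro r hr
    have hF : DiffContOnCl ℂ (fun ζ : ℂ => Complex.log (1 + r * ζ)) (ball 0 1) := by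
      refine DifferentiableOn.diffContOnCl ?_
      rw [closure_ball _ one_ne_zero]
      refine DifferentiableOn.clog (by fun_prop) fun ζ hζ => ?_
      have h1 : ‖(r : ℂ) * ζ‖ < 1 := by
        have : ‖ζ‖ ≤ 1 := by simpa using hζ
        rw [norm_mul, Complex.norm_real, Real.norm_of_nonneg hr.1.le]
        nlinarith [hr.1, hr.2]
      exact one_add_mem_slitPlane h1.le (ne_neg_one_of_norm_lt h1)
    rw [integral_arcMeasure (hmeas r), ← circleAverage_schwarz_kernel_mul_re hF (by simp) hz]
    simp only [Complex.log_re]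
  have hlim : Tendsto (fun r : ℝ => Complex.log (1 + r * z)) (𝓝[<] 1) (𝓝 (Complex.log (1 + z))) := by
    have hc : ContinuousAt (fun r : ℝ => Complex.log (1 + r * z)) 1 := by
      refine ContinuousAt.clog (by fun_prop) ?_
      simpa using one_add_mem_slitPlane hz1.le (ne_neg_one_of_norm_lt hz1)
    simpa using hc.tendsto.mono_left nhdsWithin_le_nhds
  -- The singularity is approached from inside: the formula holds for `log (1 + rζ)`, and `|1 + ζ| /
  -- 2 ≤ |1 + rζ| ≤ 2` supplies an integrable majorant as `r → 1`.
  refine tendsto_nhds_unique ?_ (hlim.congr' (by filter_upwards [hev] with r h using (hr r h).symm))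
  refine tendsto_integral_filter_of_dominated_convergence
    (fun ζ => 2 / (1 - ‖z‖) * (2 * Real.log 2 + |Real.log ‖1 + ζ‖|))
    (.of_forall fun r => (hmeas r).aestronglyMeasurable) ?_ ?_ ?_
  · filter_upwards [hev] with r hr
    filter_upwards [ae_arcMeasure_norm_eq_one, ae_arcMeasure_ne (-1)] with ζ hζ hne
    have hk : ‖(ζ + z) / (ζ - z)‖ ≤ 2 / (1 - ‖z‖) := by
      rw [norm_div]
      have h1 := norm_sub_norm_le ζ z
      have h2 := norm_add_le ζ z
      rw [hζ] at h1 h2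
      exact div_le_div₀ zero_le_two (by linarith) (by linarith) (by linarith)
    have hl := half_norm_one_add_le hζ hr.1.le hr.2.le
    have hp : 0 < ‖1 + ζ‖ := norm_pos_iff.2 (one_add_ne_zero hne)
    have hu : ‖1 + r * ζ‖ ≤ 2 := by
      have := norm_add_le (1 : ℂ) (r * ζ)
      have := norm_ofReal_mul_lt_one hζ hr
      simp only [norm_one] at *
      linarith
    have hlog1 : Real.log ‖1 + r * ζ‖ ≤ Real.log 2 := Real.log_le_log (by linarith) hu
    have hlog2 : Real.log ‖1 + ζ‖ - Real.log 2 ≤ Real.log ‖1 + r * ζ‖ := by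
      rw [← Real.log_div hp.ne' two_ne_zero]
      exact Real.log_le_log (by linarith) hl
    have hlog0 : 0 < Real.log 2 := Real.log_pos one_lt_two
    rw [norm_mul, Complex.norm_real, Real.norm_eq_abs]
    refine mul_le_mul hk ?_ (abs_nonneg _) (div_nonneg zero_le_two (by linarith))
    rw [abs_le]
    constructor <;> linarith [neg_abs_le (Real.log ‖1 + ζ‖), abs_nonneg (Real.log ‖1 + ζ‖)]
  · exact ((integrable_const _).add integrable_log_norm_one_add.abs).const_mul _
  · filter_upwards [ae_arcMeasure_ne (-1)] with ζ hne
    have hc : ContinuousAt (fun r : ℝ =>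
        (ζ + z) / (ζ - z) * ((Real.log ‖1 + r * ζ‖ : ℝ) : ℂ)) 1 := by
      refine continuousAt_const.mul (Complex.continuous_ofReal.continuousAt.comp ?_)
      refine ContinuousAt.log (by fun_prop) ?_
      simpa using one_add_ne_zero hne
    simpa using hc.tendsto.mono_left nhdsWithin_le_nhds

lemma boundaryValue_eq_of_continuousAt {f : ℂ → ℂ} {ζ : ℂ} (hf : ContinuousAt f ζ) :
    boundaryValue f ζ = f ζ := by
  refine Tendsto.limUnder_eq ?_
  have h : ContinuousAt (fun r : ℝ => f (r * ζ)) 1 :=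
    ContinuousAt.comp' (by simpa using hf) (by fun_prop)
  simpa using h.tendsto.mono_left nhdsWithin_le_nhds

/-! ### The outer functions `(1 + z) ^ α` -/

/-- The outer function `(1 + z) ^ α`. -/
noncomputable def chordPower (α : ℝ) (z : ℂ) : ℂ := (1 + z) ^ (α : ℂ)

lemma norm_chordPower (α : ℝ) (z : ℂ) : ‖chordPower α z‖ = ‖1 + z‖ ^ α :=
  Complex.norm_cpow_real _ _

lemma continuousAt_chordPower {α : ℝ} {z : ℂ} (hz : ‖z‖ ≤ 1) (hne : z ≠ -1) :
    ContinuousAt (chordPower α) z :=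
  ContinuousAt.cpow (by fun_prop) continuousAt_const (one_add_mem_slitPlane hz hne)

lemma differentiableOn_chordPower (α : ℝ) : DifferentiableOn ℂ (chordPower α) unitDisk := by
  refine DifferentiableOn.cpow (by fun_prop) (by fun_prop) fun z hz => ?_
  have hz1 : ‖z‖ < 1 := by simpa using hz
  exact one_add_mem_slitPlane hz1.le (ne_neg_one_of_norm_lt hz1)

lemma isOuter_chordPower (α : ℝ) : IsOuter (chordPower α) := by
  refine ⟨1, fun ζ => α * Real.log ‖1 + ζ‖, by simp,
    integrable_log_norm_one_add.const_mul α, fun z hz => ?_⟩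
  have hz1 : ‖z‖ < 1 := by simpa using hz
  rw [chordPower, Complex.cpow_def_of_ne_zero (one_add_ne_zero (ne_neg_one_of_norm_lt hz1)),
    ← integral_schwarz_kernel_mul_log hz, ← integral_mul_const, one_mul]
  congr 2
  ext ζ
  push_cast
  ring

lemma norm_one_add_le_two {z : ℂ} (hz : ‖z‖ ≤ 1) : ‖1 + z‖ ≤ 2 := by
  have := norm_add_le (1 : ℂ) z
  rw [norm_one] at this
  linarith

lemma chordPower_mem_hardyTwo {α : ℝ} (h₀ : 0 ≤ α) : chordPower α ∈ hardyTwo := by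
  refine ⟨differentiableOn_chordPower α, ?_⟩
  refine lt_of_le_of_lt (b := ENNReal.ofReal (2 ^ α) ^ 2) (iSup₂_le fun r hr => ?_)
    (ENNReal.pow_lt_top ENNReal.ofReal_lt_top)
  calc ∫⁻ ζ, ‖chordPower α (r * ζ)‖ₑ ^ 2 ∂arcMeasure
      ≤ ∫⁻ _, ENNReal.ofReal (2 ^ α) ^ 2 ∂arcMeasure := by
        refine lintegral_mono_ae ?_
        filter_upwards [ae_arcMeasure_norm_eq_one] with ζ hζ
        gcongr
        rw [← ofReal_norm, norm_chordPower]
        exact ENNReal.ofReal_le_ofReal (Real.rpow_le_rpow (norm_nonneg _)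
          (norm_one_add_le_two (norm_ofReal_mul_lt_one hζ hr).le) h₀)
    _ = _ := by simp

/-- A simple pole costs `|1 + z| ^ (-2)` and the weight returns `|1 + z| ^ (2α)`. The remaining
singularity has order `2 - 2α`, below `1` because `α > 1/2`; it is nonnegative because `α ≤ 1`, so a
lower bound on the chord bounds it uniformly in `r`. -/
lemma mem_weightedHardyTwo_chordPower {α C : ℝ} (hα : 1 / 2 < α) (hα₁ : α ≤ 1) {h : ℂ → ℂ}
    (hd : DifferentiableOn ℂ h unitDisk) (hC : ∀ z ∈ unitDisk, ‖h z‖ ≤ C / ‖1 + z‖) :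
    h ∈ weightedHardyTwo (chordPower α) := by
  refine ⟨hd, ?_⟩
  have hi := (integrable_norm_one_add_rpow (β := 2 - 2 * α) (by linarith)
    (by linarith)).const_mul (C ^ 2 * (1 / 2) ^ (-(2 - 2 * α)))
  have hi' := hi.lintegral_lt_top
  refine lt_of_le_of_lt (iSup₂_le fun r hr => lintegral_mono_ae ?_) hi'
  filter_upwards [ae_arcMeasure_norm_eq_one, ae_arcMeasure_ne (-1)] with ζ hζ hne
  have hlt := norm_ofReal_mul_lt_one hζ hr
  have hp : 0 < ‖1 + r * ζ‖ := norm_pos_iff.2 (one_add_ne_zero (ne_neg_one_of_norm_lt hlt))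
  have hp' : 0 < ‖1 + ζ‖ := norm_pos_iff.2 (one_add_ne_zero hne)
  have hb := hC (r * ζ) (by simpa using hlt)
  rw [← ofReal_norm, ← ofReal_norm, ← ENNReal.ofReal_pow (norm_nonneg _),
    ← ENNReal.ofReal_pow (norm_nonneg _), ← ENNReal.ofReal_mul (by positivity)]
  refine ENNReal.ofReal_le_ofReal ?_
  rw [norm_chordPower]
  calc ‖h (r * ζ)‖ ^ 2 * (‖1 + r * ζ‖ ^ α) ^ 2
      ≤ (C / ‖1 + r * ζ‖) ^ 2 * (‖1 + r * ζ‖ ^ α) ^ 2 := by gcongr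
    _ = C ^ 2 * ‖1 + r * ζ‖ ^ (-(2 - 2 * α)) := by
        have e : -(2 - 2 * α) = α * (2 : ℕ) - (2 : ℕ) := by push_cast; ring
        rw [e, Real.rpow_sub hp, Real.rpow_mul_natCast hp.le, Real.rpow_natCast]
        ring
    _ ≤ C ^ 2 * (1 / 2 * ‖1 + ζ‖) ^ (-(2 - 2 * α)) := by
        refine mul_le_mul_of_nonneg_left ?_ (sq_nonneg C)
        refine Real.rpow_le_rpow_of_nonpos (by positivity) ?_ (by linarith)
        linarith [half_norm_one_add_le hζ hr.1.le hr.2.le]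
    _ = _ := by rw [Real.mul_rpow (by norm_num) hp'.le]; ring

lemma memLp_one_div_boundaryValue_chordPower {α : ℝ} {s : ℝ≥0∞} (hα : 0 ≤ α) (hs : s ≠ ⊤)
    (hαs : α * s.toReal < 1) :
    MemLp (fun ζ => 1 / boundaryValue (chordPower α) ζ) s arcMeasure := by
  have hae : (fun ζ => 1 / chordPower α ζ) =ᵐ[arcMeasure]
      fun ζ => 1 / boundaryValue (chordPower α) ζ := by
    filter_upwards [ae_arcMeasure_norm_eq_one, ae_arcMeasure_ne (-1)] with ζ hζ hne
    rw [boundaryValue_eq_of_continuousAt (continuousAt_chordPower hζ.le hne)]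
  refine MemLp.ae_eq hae ?_
  have hm : AEStronglyMeasurable (fun ζ => 1 / chordPower α ζ) arcMeasure :=
    Measurable.aestronglyMeasurable (by unfold chordPower; fun_prop)
  rcases eq_or_ne s 0 with rfl | h0
  · exact memLp_zero_iff_aestronglyMeasurable.2 hm
  rw [← integrable_norm_rpow_iff hm h0 hs]
  refine (integrable_norm_one_add_rpow (β := α * s.toReal)
    (mul_nonneg hα ENNReal.toReal_nonneg) hαs).congr (.of_forall fun ζ => ?_)
  simp only [one_div, norm_inv, norm_chordPower]
  rw [← Real.rpow_neg (norm_nonneg _), ← Real.rpow_mul (norm_nonneg _), neg_mul]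

/-! ### The singular inner function with mass at `1` -/

/-- The singular inner function `exp ((z + 1) / (z - 1))`. -/
noncomputable def atomicInner (z : ℂ) : ℂ := Complex.exp ((z + 1) / (z - 1))

/-- The exponent on the right is the real part of `(z + 1) / (z - 1)`. At `z = 1` both sides equal
`1`, since division by zero gives zero. -/
lemma norm_atomicInner (z : ℂ) :
    ‖atomicInner z‖ = Real.exp ((‖z‖ ^ 2 - 1) / ‖z - 1‖ ^ 2) := by
  rw [atomicInner, Complex.norm_exp, Complex.div_re, ← Complex.normSq_eq_norm_sq,
    ← Complex.normSq_eq_norm_sq, ← add_div, Complex.normSq_apply z]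
  congr 2
  simp
  ring

lemma norm_atomicInner_le_one {z : ℂ} (hz : ‖z‖ ≤ 1) : ‖atomicInner z‖ ≤ 1 := by
  rw [norm_atomicInner, Real.exp_le_one_iff]
  exact div_nonpos_of_nonpos_of_nonneg (by nlinarith [norm_nonneg z]) (sq_nonneg _)

lemma norm_atomicInner_eq_one {z : ℂ} (hz : ‖z‖ = 1) : ‖atomicInner z‖ = 1 := by
  simp [norm_atomicInner, hz]

lemma continuousAt_atomicInner {z : ℂ} (hz : z ≠ 1) : ContinuousAt atomicInner z := by
  have h : ContinuousAt (fun w : ℂ => (w + 1) / (w - 1)) z :=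
    ContinuousAt.div (by fun_prop) (by fun_prop) (sub_ne_zero.2 hz)
  exact h.cexp

lemma differentiableOn_atomicInner : DifferentiableOn ℂ atomicInner unitDisk := by
  refine (DifferentiableOn.div (by fun_prop) (by fun_prop) fun z hz h => ?_).cexp
  rw [sub_eq_zero] at h
  simp [h] at hz

lemma isInner_atomicInner : IsInner atomicInner := by
  refine ⟨differentiableOn_atomicInner, ⟨1, fun z hz => norm_atomicInner_le_one ?_⟩, ?_⟩
  · exact (by simpa using hz : ‖z‖ < 1).le
  · filter_upwards [ae_arcMeasure_norm_eq_one, ae_arcMeasure_ne 1] with ζ hζ hne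
    rw [boundaryValue_eq_of_continuousAt (continuousAt_atomicInner hne),
      norm_atomicInner_eq_one hζ]

lemma notMem_innerSpectrum_atomicInner {ζ : ℂ} (hζ : ‖ζ‖ = 1) (hne : ζ ≠ 1) :
    ζ ∉ innerSpectrum atomicInner := by
  rintro ⟨-, h⟩
  have : (𝓝[unitDisk] ζ).NeBot := by
    rw [← mem_closure_iff_nhdsWithin_neBot, closure_ball _ one_ne_zero]
    simp [hζ]
  have ht : Tendsto (fun z => ‖atomicInner z‖ₑ) (𝓝[unitDisk] ζ) (𝓝 ‖atomicInner ζ‖ₑ) :=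
    (continuousAt_atomicInner hne).enorm.tendsto.mono_left nhdsWithin_le_nhds
  rw [ht.liminf_eq, ← ofReal_norm, norm_atomicInner_eq_one hζ] at h
  simp at h

lemma atomicInner_zero : atomicInner 0 = (Real.exp (-1) : ℝ) := by
  simp [atomicInner]

lemma exp_neg_one_le_half : Real.exp (-1) ≤ 1 / 2 := by
  rw [Real.exp_neg, one_div]
  exact inv_anti₀ two_pos (by linarith [Real.add_one_le_exp 1])

/-! ### A function with a pole at `-1` in the weighted model space -/

/-- A conformal map of the disk onto a half-plane, real on the circle, with a pole at `-1`. -/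
noncomputable def cayleyPole (z : ℂ) : ℂ := Complex.I * ((1 - z) / (1 + z))

/-- The reproducing kernel of the model space at `0`, multiplied by `cayleyPole`. -/
noncomputable def kernelPole (z : ℂ) : ℂ := (1 - Real.exp (-1) * atomicInner z) * cayleyPole z

/-- The conjugate of `kernelPole` with respect to `atomicInner`. -/
noncomputable def kernelPoleConj (z : ℂ) : ℂ := (atomicInner z - Real.exp (-1)) * cayleyPole z

lemma differentiableOn_cayleyPole : DifferentiableOn ℂ cayleyPole unitDisk :=
  (DifferentiableOn.div (by fun_prop) (by fun_prop) fun z hz =>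
    one_add_ne_zero (ne_neg_one_of_norm_lt (by simpa using hz))).const_mul _

lemma continuousAt_cayleyPole {z : ℂ} (hz : z ≠ -1) : ContinuousAt cayleyPole z :=
  continuousAt_const.mul (ContinuousAt.div (by fun_prop) (by fun_prop) (one_add_ne_zero hz))

lemma norm_cayleyPole (z : ℂ) : ‖cayleyPole z‖ = ‖1 - z‖ / ‖1 + z‖ := by
  simp [cayleyPole]

lemma norm_mul_cayleyPole_le {a z : ℂ} (ha : ‖a‖ ≤ 2) (hz : z ∈ unitDisk) :
    ‖a * cayleyPole z‖ ≤ 4 / ‖1 + z‖ := by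
  have hz1 : ‖z‖ < 1 := by simpa using hz
  have h : ‖1 - z‖ ≤ 2 := by
    have := norm_sub_le (1 : ℂ) z
    rw [norm_one] at this
    linarith
  rw [norm_mul, norm_cayleyPole, ← mul_div_assoc]
  gcongr
  nlinarith [norm_nonneg a, norm_nonneg (1 - z)]

lemma norm_exp_neg_one_mul_atomicInner_le {z : ℂ} (hz : ‖z‖ ≤ 1) :
    ‖(Real.exp (-1) : ℂ) * atomicInner z‖ ≤ 1 / 2 := by
  rw [norm_mul, Complex.norm_real, Real.norm_of_nonneg (Real.exp_nonneg _)]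
  nlinarith [norm_atomicInner_le_one hz, norm_nonneg (atomicInner z), exp_neg_one_le_half,
    Real.exp_pos (-1)]

lemma conj_cayleyPole {ζ : ℂ} (hζ : ‖ζ‖ = 1) (hne : ζ ≠ -1) :
    conj (cayleyPole ζ) = cayleyPole ζ := by
  have hζ0 : ζ ≠ 0 := by rintro rfl; simp at hζ
  have hc : conj ζ = ζ⁻¹ := by
    rw [Complex.inv_def, Complex.normSq_eq_norm_sq, hζ]; simp
  have h1 := one_add_ne_zero hne
  have h2 : ζ + 1 ≠ 0 := by rwa [add_comm]
  simp only [cayleyPole, map_mul, Complex.conj_I, map_div₀, map_sub, map_add, map_one, hc]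
  field_simp
  ring

/-- On the circle `I * conj (I - e⁻¹) = 1 - e⁻¹ I`, and the real factor `cayleyPole` can be carried
along. The conjugate function vanishes at `0` because `I 0 = e⁻¹`. -/
lemma kernelPole_mem_weightedModelSpace {α : ℝ} (hα : 1 / 2 < α) (hα₁ : α ≤ 1) :
    kernelPole ∈ weightedModelSpace atomicInner (chordPower α) := by
  have hI := differentiableOn_atomicInner
  have hP := differentiableOn_cayleyPole
  refine ⟨mem_weightedHardyTwo_chordPower (C := 4) hα hα₁ ?_ fun z hz => ?_, kernelPoleConj,
    mem_weightedHardyTwo_chordPower (C := 4) hα hα₁ ?_ fun z hz => ?_, ?_, ?_⟩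
  · exact ((hI.const_mul _).const_sub _).mul hP
  · refine norm_mul_cayleyPole_le ?_ hz
    have h1 := norm_exp_neg_one_mul_atomicInner_le (by simpa using hz : ‖z‖ < 1).le
    have h2 := norm_sub_le (1 : ℂ) (Real.exp (-1) * atomicInner z)
    rw [norm_one] at h2
    linarith
  · exact (hI.sub_const _).mul hP
  · refine norm_mul_cayleyPole_le ?_ hz
    have h1 := norm_atomicInner_le_one (by simpa using hz : ‖z‖ < 1).le
    have h2 := norm_sub_le (atomicInner z) (Real.exp (-1))
    rw [Complex.norm_real, Real.norm_of_nonneg (Real.exp_nonneg _)] at h2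
    linarith [exp_neg_one_le_half]
  · simp [kernelPoleConj, atomicInner_zero]
  · filter_upwards [ae_arcMeasure_norm_eq_one, ae_arcMeasure_ne 1, ae_arcMeasure_ne (-1)]
      with ζ hζ hne hne'
    have hcI := continuousAt_atomicInner hne
    have hcP := continuousAt_cayleyPole hne'
    have h1 : ContinuousAt kernelPole ζ :=
      (continuousAt_const.sub (continuousAt_const.mul hcI)).mul hcP
    have h2 : ContinuousAt kernelPoleConj ζ := (hcI.sub continuousAt_const).mul hcP
    rw [boundaryValue_eq_of_continuousAt h1, boundaryValue_eq_of_continuousAt h2,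
      boundaryValue_eq_of_continuousAt hcI]
    have h3 : atomicInner ζ * conj (atomicInner ζ) = 1 := by
      rw [Complex.mul_conj, Complex.normSq_eq_norm_sq, norm_atomicInner_eq_one hζ]
      simp
    simp only [kernelPole, kernelPoleConj, map_mul, map_sub, Complex.conj_ofReal,
      conj_cayleyPole hζ hne']
    linear_combination (-cayleyPole ζ) * h3

lemma norm_one_add_circleMap_le (t : ℝ) : ‖1 + circleMap 0 1 t‖ ≤ |t + Real.pi| := by
  have h := (lipschitzWith_circleMap 0 1).dist_le_mul t (-Real.pi)
  rw [dist_eq_norm, Real.dist_eq] at h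
  simpa [circleMap, Complex.exp_neg, add_comm] using h

/-- Such points are within `2d` of `-1`, where `|1 - z| ≥ 1` and the kernel factor is at least
`1/2`. -/
lemma le_norm_kernelPole {d t : ℝ} (hd : d ∈ Set.Ioo (0 : ℝ) (1 / 2))
    (ht : t ∈ Set.Ioc (-Real.pi) (-Real.pi + d)) :
    1 / (4 * d) ≤ ‖kernelPole ((1 - d : ℝ) * circleMap 0 1 t)‖ := by
  set ζ := circleMap 0 1 t with hζ_def
  have hζ : ‖ζ‖ = 1 := by simp [hζ_def]
  have hlt : ‖((1 - d : ℝ) : ℂ) * ζ‖ < 1 :=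
    norm_ofReal_mul_lt_one hζ ⟨by linarith [hd.2], by linarith [hd.1]⟩
  set z := ((1 - d : ℝ) : ℂ) * ζ with hz_def
  have h1 : ‖1 + ζ‖ ≤ d := by
    refine (norm_one_add_circleMap_le t).trans ?_
    rw [abs_of_nonneg (by linarith [ht.1])]
    linarith [ht.2]
  have h2 : ‖1 + z‖ ≤ 2 * d := by
    have e : 1 + z = (1 + ζ) - (d : ℂ) * ζ := by rw [hz_def]; push_cast; ring
    have h := norm_sub_le (1 + ζ) ((d : ℂ) * ζ)
    rw [← e, norm_mul, hζ, Complex.norm_real, Real.norm_of_nonneg hd.1.le] at h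
    linarith
  have h3 : 1 ≤ ‖1 - z‖ := by
    have h := norm_sub_norm_le (2 : ℂ) (1 + z)
    rw [show (2 : ℂ) - (1 + z) = 1 - z by ring, Complex.norm_ofNat] at h
    linarith [hd.2]
  have h4 : 1 / 2 ≤ ‖1 - Real.exp (-1) * atomicInner z‖ := by
    have h := norm_sub_norm_le (1 : ℂ) (Real.exp (-1) * atomicInner z)
    rw [norm_one] at h
    linarith [norm_exp_neg_one_mul_atomicInner_le hlt.le]
  have hp : 0 < ‖1 + z‖ := norm_pos_iff.2 (one_add_ne_zero (ne_neg_one_of_norm_lt hlt))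
  have hd0 := hd.1
  rw [kernelPole, norm_mul, norm_cayleyPole]
  calc 1 / (4 * d) = 1 / 2 * (1 / (2 * d)) := by field_simp; norm_num
    _ ≤ _ := by gcongr

/-- At radius `1 - d`, an arc of length `d` next to `-1` alone contributes at least `d / (4d)² /
(2π) = 1 / (32πd)`, which is unbounded as `d → 0`. -/
lemma kernelPole_notMem_hardyTwo : kernelPole ∉ hardyTwo := by
  rintro ⟨-, h⟩
  set K := ⨆ r ∈ Set.Ioo (0 : ℝ) 1, ∫⁻ ζ, ‖kernelPole (r * ζ)‖ₑ ^ 2 ∂arcMeasure with hK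
  have hpi := Real.pi_pos
  have key : ∀ d ∈ Set.Ioo (0 : ℝ) (1 / 2), 1 / (32 * Real.pi * d) ≤ K.toReal := by
    intro d hd
    have hd0 := hd.1
    refine (ENNReal.ofReal_le_iff_le_toReal h.ne).1 ?_
    refine le_trans ?_ (le_iSup₂ (f := fun (r : ℝ) (_ : r ∈ Set.Ioo (0 : ℝ) 1) =>
      ∫⁻ ζ, ‖kernelPole (r * ζ)‖ₑ ^ 2 ∂arcMeasure) (1 - d)
      ⟨by linarith [hd.2], by linarith [hd.1]⟩)
    have hm : Measurable (fun ζ : ℂ => ‖kernelPole ((1 - d : ℝ) * ζ)‖ₑ ^ 2) := by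
      unfold kernelPole cayleyPole atomicInner
      fun_prop
    rw [lintegral_arcMeasure hm]
    calc ENNReal.ofReal (1 / (32 * Real.pi * d))
        = (ENNReal.ofReal (2 * Real.pi))⁻¹ * (ENNReal.ofReal ((1 / (4 * d)) ^ 2) *
            ENNReal.ofReal d) := by
          rw [← ENNReal.ofReal_inv_of_pos (by positivity), ← ENNReal.ofReal_mul (by positivity),
            ← ENNReal.ofReal_mul (by positivity)]
          congr 1
          field_simp
          norm_num
      _ = (ENNReal.ofReal (2 * Real.pi))⁻¹ * ∫⁻ _ in Set.Ioc (-Real.pi) (-Real.pi + d),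
            ENNReal.ofReal ((1 / (4 * d)) ^ 2) := by
          rw [setLIntegral_const, Real.volume_Ioc]
          congr 3
          ring
      _ ≤ (ENNReal.ofReal (2 * Real.pi))⁻¹ * ∫⁻ t in Set.Ioc (-Real.pi) (-Real.pi + d),
            ‖kernelPole ((1 - d : ℝ) * circleMap 0 1 t)‖ₑ ^ 2 := by
          gcongr 1
          refine setLIntegral_mono (hm.comp measurable_circleMap_zero_one) fun t ht => ?_
          rw [← ofReal_norm, ← ENNReal.ofReal_pow (norm_nonneg _)]
          refine ENNReal.ofReal_le_ofReal ?_
          have := le_norm_kernelPole hd ht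
          gcongr
      _ ≤ _ := by
          gcongr 1
          refine lintegral_mono_set (Set.Ioc_subset_Ioc_right ?_)
          linarith [hd.2, Real.pi_gt_three]
  have hK0 : 0 ≤ K.toReal := ENNReal.toReal_nonneg
  have hpos : 0 < 32 * Real.pi * (K.toReal + 1) := by positivity
  have hbig : 2 < 32 * Real.pi * (K.toReal + 1) := by nlinarith [Real.pi_gt_three]
  -- This `d` turns the lower bound into `K.toReal + 1`.
  have := key (1 / (32 * Real.pi * (K.toReal + 1)))
    ⟨by positivity, one_div_lt_one_div_of_lt two_pos hbig⟩
  have e : 1 / (32 * Real.pi * (1 / (32 * Real.pi * (K.toReal + 1)))) = K.toReal + 1 := by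
    field_simp
  linarith

/-! ### The arcs -/

/-- Endpoints of the arcs, decreasing to `0`. -/
noncomputable def arcEndpoint (k : ℕ) : ℝ := 3 * Real.pi / 2 / (2 * k + 1)

/-- A sequence of disjoint closed arcs accumulating at `1`; the first one is the left half-circle. -/
noncomputable def arcSeq (n : ℕ) : Set ℂ :=
  (fun t : ℝ => circleMap 0 1 t) '' Set.Icc (arcEndpoint (2 * n + 1)) (arcEndpoint (2 * n))

lemma arcEndpoint_pos (k : ℕ) : 0 < arcEndpoint k := by
  have := Real.pi_pos
  unfold arcEndpoint
  positivity

lemma arcEndpoint_strictAnti : StrictAnti arcEndpoint := by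
  intro m n hmn
  have := Real.pi_pos
  have : (m : ℝ) < n := by exact_mod_cast hmn
  unfold arcEndpoint
  gcongr

lemma arcEndpoint_zero : arcEndpoint 0 = 3 * Real.pi / 2 := by simp [arcEndpoint]

lemma arcEndpoint_one : arcEndpoint 1 = Real.pi / 2 := by
  simp [arcEndpoint]
  ring

lemma arcEndpoint_lt_two_pi (k : ℕ) : arcEndpoint k < 2 * Real.pi := by
  have := arcEndpoint_strictAnti.antitone (Nat.zero_le k)
  rw [arcEndpoint_zero] at this
  linarith [Real.pi_pos]

lemma isClosedArc_arcSeq (n : ℕ) : IsClosedArc (arcSeq n) :=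
  ⟨_, _, arcEndpoint_strictAnti (Nat.lt_succ_self _),
    by linarith [arcEndpoint_lt_two_pi (2 * n), arcEndpoint_pos (2 * n + 1)], rfl⟩

lemma injOn_circleMap_Ico : Set.InjOn (fun t : ℝ => circleMap 0 1 t) (Set.Ico 0 (2 * Real.pi)) :=
  injOn_circleMap_of_abs_sub_le' one_ne_zero (by simp)

lemma pairwise_disjoint_arcSeq : Pairwise fun m n => Disjoint (arcSeq m) (arcSeq n) := by
  refine (pairwise_disjoint_on arcSeq).2 ?_
  intro m n hmn
  rw [Set.disjoint_left]
  rintro _ ⟨s, hs, rfl⟩ ⟨t, ht, h⟩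
  have hst : t = s := injOn_circleMap_Ico
    ⟨(arcEndpoint_pos _).le.trans ht.1, ht.2.trans_lt (arcEndpoint_lt_two_pi _)⟩
    ⟨(arcEndpoint_pos _).le.trans hs.1, hs.2.trans_lt (arcEndpoint_lt_two_pi _)⟩ h
  have := arcEndpoint_strictAnti (show 2 * m + 1 < 2 * n by omega)
  linarith [hs.1, ht.2]

lemma disjoint_arcSeq_innerSpectrum (n : ℕ) :
    Disjoint (arcSeq n) (innerSpectrum atomicInner) := by
  rw [Set.disjoint_left]
  rintro _ ⟨t, ht, rfl⟩
  refine notMem_innerSpectrum_atomicInner (by simp) fun h => ?_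
  have ht0 : 0 < t := (arcEndpoint_pos _).trans_le ht.1
  have : t = 0 := injOn_circleMap_Ico
    ⟨ht0.le, ht.2.trans_lt (arcEndpoint_lt_two_pi _)⟩
    ⟨le_rfl, Real.two_pi_pos⟩ (by simpa [circleMap] using h)
  exact ht0.ne' this

lemma one_le_norm_one_add_of_notMem_arcSeq {ζ : ℂ} (hζ : ‖ζ‖ = 1) (h : ζ ∉ arcSeq 0) :
    1 ≤ ‖1 + ζ‖ := by
  have hre : 0 ≤ ζ.re := by
    by_contra! hneg
    apply h
    have hζe : ζ = circleMap 0 1 ζ.arg := by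
      have := Complex.norm_mul_exp_arg_mul_I ζ
      rw [hζ] at this
      simpa [circleMap] using this.symm
    have habs : Real.pi / 2 < |ζ.arg| := by
      by_contra! hle
      exact absurd (Complex.abs_arg_le_pi_div_two_iff.1 hle) (by linarith)
    have hle := Complex.arg_le_pi ζ
    have hge := Complex.neg_pi_lt_arg ζ
    have hpi := Real.pi_pos
    simp only [arcSeq, mul_zero, zero_add, arcEndpoint_zero, arcEndpoint_one]
    -- The argument lies in `(-π, π]` while the arc is parametrized by `[π/2, 3π/2]`, so negative
    -- arguments are shifted by `2π`.
    rcases lt_abs.1 habs with h1 | h1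
    · exact ⟨ζ.arg, ⟨h1.le, by linarith⟩, hζe.symm⟩
    · refine ⟨ζ.arg + 2 * Real.pi, ⟨by linarith, by linarith⟩, ?_⟩
      have := periodic_circleMap 0 1 ζ.arg
      simp only [this, ← hζe]
  have := Complex.re_le_norm (1 + ζ)
  simp only [Complex.add_re, Complex.one_re] at this
  linarith

end HardyModel

theorem proposition5 :
    ∃ (I : ℂ → ℂ) (Γ : ℕ → Set ℂ) (δ : ℝ),
      (∀ z ∈ unitDisk, I z = Complex.exp ((z + 1) / (z - 1))) ∧
      IsInner I ∧
      (∀ n, IsClosedArc (Γ n)) ∧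
      Pairwise (fun m n => Disjoint (Γ m) (Γ n)) ∧
      (∀ n, Disjoint (Γ n) (innerSpectrum I)) ∧
      0 < δ ∧
      ∀ s : ℝ≥0∞, s < 2 →
        ∃ g : ℂ → ℂ,
          IsOuter g ∧ g ∈ hardyTwo ∧
          MemLp (fun ζ => 1 / boundaryValue g ζ) s (arcMeasure.restrict (⋃ n, Γ n)) ∧
          (∀ᵐ ζ ∂arcMeasure, ζ ∉ (⋃ n, Γ n) →
            δ ≤ ‖boundaryValue g ζ‖ ∧ δ ≤ ‖1 / boundaryValue g ζ‖) ∧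
          ¬ (weightedModelSpace I g ⊆ modelSpace I) := by
  refine ⟨atomicInner, arcSeq, 1 / 2, fun z _ => rfl, isInner_atomicInner, isClosedArc_arcSeq,
    pairwise_disjoint_arcSeq, disjoint_arcSeq_innerSpectrum, one_half_pos, fun s hs => ?_⟩
  have hs_top : s ≠ ⊤ := (hs.trans (by simp)).ne
  have ht0 : 0 ≤ s.toReal := ENNReal.toReal_nonneg
  have ht2 : s.toReal < 2 := by
    have := (ENNReal.toReal_lt_toReal hs_top (by simp)).2 hs
    simpa using this
  obtain ⟨α, hα, hα₁, hαs⟩ : ∃ α : ℝ, 1 / 2 < α ∧ α ≤ 1 ∧ α * s.toReal < 1 := by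
    -- The reciprocal of this `α` is the midpoint of `s` and `2`, so `α` exceeds `1/2` and `α * s <
    -- 1`, including for `s = 0`.
    refine ⟨2 / (2 + s.toReal), ?_, ?_, ?_⟩
    · rw [div_lt_div_iff₀ two_pos (by linarith)]; linarith
    · rw [div_le_one (by linarith)]; linarith
    · rw [div_mul_eq_mul_div, div_lt_one (by linarith)]; linarith
  refine ⟨chordPower α, isOuter_chordPower α, chordPower_mem_hardyTwo (by linarith),
    (memLp_one_div_boundaryValue_chordPower (by linarith) hs_top hαs).restrict _, ?_,
    fun h => kernelPole_notMem_hardyTwo (h (kernelPole_mem_weightedModelSpace hα hα₁)).1⟩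
  -- Off the first arc `1 ≤ |1 + ζ| ≤ 2` and `0 < α ≤ 1`, so `1 ≤ |g| ≤ 2`; hence `δ = 1/2` works
  -- for every `s`.
  filter_upwards [ae_arcMeasure_norm_eq_one, ae_arcMeasure_ne (-1)] with ζ hζ hne hmem
  rw [boundaryValue_eq_of_continuousAt (continuousAt_chordPower hζ.le hne), norm_div, norm_one,
    norm_chordPower]
  have h1 : 1 ≤ ‖1 + ζ‖ := one_le_norm_one_add_of_notMem_arcSeq hζ fun h =>
    hmem (Set.mem_iUnion.2 ⟨0, h⟩)
  have h2 : 1 ≤ ‖1 + ζ‖ ^ α := Real.one_le_rpow h1 (by linarith)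
  have h3 : ‖1 + ζ‖ ^ α ≤ 2 := by
    calc ‖1 + ζ‖ ^ α ≤ ‖1 + ζ‖ ^ (1 : ℝ) := Real.rpow_le_rpow_of_exponent_le h1 hα₁
      _ ≤ 2 := by rw [Real.rpow_one]; exact norm_one_add_le_two hζ.le
  exact ⟨by linarith, one_div_le_one_div_of_le (by linarith) h3⟩
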